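/- A (two-sided) restriction monoid is an algebra $(S;\cdot,{}^*,{}^+,1)$ of type $(2,1,1,0)$ such that $(S;\cdot,1)$ is a monoid and, for all $x,y\in S$, $$xx^*=x,\quad x^*y^*=y^*x^*,\quad (xy^*)^*=x^*y^*,\quad x^*y=y(xy)^*,$$ $$x^+x=x,\quad x^+y^+=y^+x^+,\quad (x^+y)^+=x^+y^+,\quad xy^+=(xy)^+x,$$ $$(x^+)^*=x^+,\quad (x^*)^+=x^*.$$ An inverse monoid is an algebra $(S;\cdot,{}^{-1},1)$ such that $(S;\cdot,1)$ is a monoid, $(x^{-1})^{-1}=x$, $(xy)^{-1}=y^{-1}x^{-1}$, $xx^{-1}x=x$ and $xx^{-1}yy^{-1}=yy^{-1}xx^{-1}$ for all $x,y\in S$. Every inverse monoid is regarded as a restriction monoid by putting $x^*=x^{-1}x$ and $x^+=xx^{-1}$. Let $G$ be a group. - Let $\mathcal{FR}_s(G)$ be the restriction monoid generated by a bijective copy $\{\lfloor g\rfloor: g\in G\}$ of $G$ subject to the defining relations $\lfloor 1\rfloor=1$, $\lfloor g\rfloor\lfloor h\rfloor=\lfloor g\rfloor^+\lfloor gh\rfloor$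 and $\lfloor g\rfloor\lfloor h\rfloor=\lfloor gh\rfloor\lfloor h\rfloor^*$ for all $g,h\in G$. - Let $\mathcal{FI}_s(G)$ be the inverse monoid generated by a bijective copy $\{[g]: g\in G\}$ of $G$ subject to the defining relations $[1]=1$, $[g][h]=[g][g]^{-1}[gh]$ and $[g][h]=[gh][h]^{-1}[h]$ for all $g,h\in G$. - Let $\tilde G^{\mathcal R}$ be the Birget–Rhodes prefix expansion of $G$: the inverse monoid of all pairs $(A,g)$, where $A\subseteq G$ is a finite subset with $1,g\in A$ (equivalently, the pairs $(\{1,g_1,g_1g_2,\dots,g_1\cdots g_n\},\,g_1\cdots g_n)$ with $n\ge 0$ and $g_i\in G$), with the operations $(A,g)(B,h)=(A\cup gB,gh)$ and $(A,g)^{-1}=(g^{-1}A,g^{-1})$ and the identity element $(\{1\},1)$. Then $\mathcal{FR}_s(G)$ is an inverse monoid, that is, there is an inverse monoid structure on the set $\mathcal{FR}_s(G)$ whose associated restriction monoid is $\mathcal{FR}_s(G)$ itself (same multiplication and identity element, and $x^*=x^{-1}x$, $x^+=xx^{-1}$ for all $x$). Moreover, as an inverse monoid, $\mathcal{FR}_s(G)$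 is isomorphic to $\mathcal{FI}_s(G)$ and to $\tilde G^{\mathcal R}$. -/

import Mathlib

universe u v

/-! ### Restriction monoids and inverse monoids -/

/-- A (two-sided) restriction monoid: an algebra `(S; *, rstar, rplus, 1)` of type `(2,1,1,0)`;
`rstar x` is `x^*` and `rplus x` is `x^+`. -/
class RestrictionMonoid (S : Type u) extends Monoid S where
  rstar : S → S
  rplus : S → S
  mul_rstar_self : ∀ x : S, x * rstar x = x
  rstar_comm : ∀ x y : S, rstar x * rstar y = rstar y * rstar x
  rstar_mul_rstar : ∀ x y : S, rstar (x * rstar y) = rstar x * rstar y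
  rstar_mul : ∀ x y : S, rstar x * y = y * rstar (x * y)
  rplus_mul_self : ∀ x : S, rplus x * x = x
  rplus_comm : ∀ x y : S, rplus x * rplus y = rplus y * rplus x
  rplus_rplus_mul : ∀ x y : S, rplus (rplus x * y) = rplus x * rplus y
  mul_rplus : ∀ x y : S, x * rplus y = rplus (x * y) * x
  rstar_rplus : ∀ x : S, rstar (rplus x) = rplus x
  rplus_rstar : ∀ x : S, rplus (rstar x) = rstar x

/-- An inverse monoid, as an algebra of type `(2,1,0)`. -/
class InverseMonoid (S : Type u) extends Monoid S, Inv S where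
  inv_inv' : ∀ x : S, x⁻¹⁻¹ = x
  mul_inv_rev' : ∀ x y : S, (x * y)⁻¹ = y⁻¹ * x⁻¹
  mul_inv_mul_self : ∀ x : S, x * x⁻¹ * x = x
  mul_inv_comm : ∀ x y : S, x * x⁻¹ * (y * y⁻¹) = y * y⁻¹ * (x * x⁻¹)

namespace InverseMonoid

variable {S : Type u} [InverseMonoid S]

theorem inv_mul_mul_inv (x : S) : x⁻¹ * x * x⁻¹ = x⁻¹ := by
  have h := mul_inv_mul_self x⁻¹
  rwa [inv_inv'] at h

theorem inv_mul_comm (x y : S) : x⁻¹ * x * (y⁻¹ * y) = y⁻¹ * y * (x⁻¹ * x) := by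
  have h := mul_inv_comm x⁻¹ y⁻¹
  rwa [inv_inv', inv_inv'] at h

theorem inv_mul_mul_inv_comm (x y : S) : x⁻¹ * x * (y * y⁻¹) = y * y⁻¹ * (x⁻¹ * x) := by
  have h := mul_inv_comm x⁻¹ y
  rwa [inv_inv'] at h

/-- Every inverse monoid is a restriction monoid, with `x^* = x⁻¹ x` and `x^+ = x x⁻¹`. -/
@[reducible] def toRestrictionMonoid (S : Type u) [InverseMonoid S] : RestrictionMonoid S where
  rstar x := x⁻¹ * x
  rplus x := x * x⁻¹
  mul_rstar_self x := by rw [← mul_assoc, mul_inv_mul_self]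
  rstar_comm := inv_mul_comm
  rstar_mul_rstar x y := by
    rw [mul_inv_rev', mul_inv_rev', inv_inv']
    calc y⁻¹ * y * x⁻¹ * (x * (y⁻¹ * y))
        = y⁻¹ * y * (x⁻¹ * x * (y⁻¹ * y)) := by simp only [mul_assoc]
      _ = y⁻¹ * y * (y⁻¹ * y * (x⁻¹ * x)) := by rw [inv_mul_comm x y]
      _ = y⁻¹ * y * y⁻¹ * y * (x⁻¹ * x) := by simp only [mul_assoc]
      _ = x⁻¹ * x * (y⁻¹ * y) := by rw [inv_mul_mul_inv, inv_mul_comm]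
  rstar_mul x y := by
    rw [mul_inv_rev']
    calc x⁻¹ * x * y = x⁻¹ * x * (y * y⁻¹ * y) := by rw [mul_inv_mul_self]
      _ = x⁻¹ * x * (y * y⁻¹) * y := by simp only [mul_assoc]
      _ = y * y⁻¹ * (x⁻¹ * x) * y := by rw [inv_mul_mul_inv_comm]
      _ = y * (y⁻¹ * x⁻¹ * (x * y)) := by simp only [mul_assoc]
  rplus_mul_self := mul_inv_mul_self
  rplus_comm := mul_inv_comm
  rplus_rplus_mul x y := by
    rw [mul_inv_rev', mul_inv_rev', inv_inv']
    calc x * x⁻¹ * y * (y⁻¹ * (x * x⁻¹))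
        = x * x⁻¹ * (y * y⁻¹ * (x * x⁻¹)) := by simp only [mul_assoc]
      _ = x * x⁻¹ * (x * x⁻¹ * (y * y⁻¹)) := by rw [mul_inv_comm x y]
      _ = x * x⁻¹ * x * x⁻¹ * (y * y⁻¹) := by simp only [mul_assoc]
      _ = x * x⁻¹ * (y * y⁻¹) := by rw [mul_inv_mul_self]
  mul_rplus x y := by
    rw [mul_inv_rev']
    calc x * (y * y⁻¹) = x * x⁻¹ * x * (y * y⁻¹) := by rw [mul_inv_mul_self]
      _ = x * (x⁻¹ * x * (y * y⁻¹)) := by simp only [mul_assoc]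
      _ = x * (y * y⁻¹ * (x⁻¹ * x)) := by rw [inv_mul_mul_inv_comm]
      _ = x * y * (y⁻¹ * x⁻¹) * x := by simp only [mul_assoc]
  rstar_rplus x := by
    rw [mul_inv_rev', inv_inv', ← mul_assoc, mul_inv_mul_self]
  rplus_rstar x := by
    rw [mul_inv_rev', inv_inv', ← mul_assoc, inv_mul_mul_inv]

end InverseMonoid

/-- Isomorphisms of inverse monoids (as algebras of type `(2,1,0)`; preservation of `1` is
automatic for multiplicative bijections of monoids). -/
structure InverseMonoidIso (S : Type u) (T : Type v) [InverseMonoid S] [InverseMonoid T]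
    extends S ≃* T where
  map_inv' : ∀ x : S, toFun x⁻¹ = (toFun x)⁻¹

/-! ### Restriction monoids given by generators and relations -/

/-- Terms of type `(2,1,1,0)` over a set `X` of generators. -/
inductive RTerm (X : Type u) : Type u
  | of : X → RTerm X
  | one : RTerm X
  | mul : RTerm X → RTerm X → RTerm X
  | rstar : RTerm X → RTerm X
  | rplus : RTerm X → RTerm X

/-- The least congruence on the algebra of terms that contains the relations `R` and all
instances of the defining identities of restriction monoids. -/
inductive RTerm.Cong {X : Type u} (R : RTerm X → RTerm X → Prop) : RTerm X → RTerm X → Prop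
  | rel {a b : RTerm X} : R a b → Cong R a b
  | refl (a : RTerm X) : Cong R a a
  | symm {a b : RTerm X} : Cong R a b → Cong R b a
  | trans {a b c : RTerm X} : Cong R a b → Cong R b c → Cong R a c
  | mul_congr {a b c d : RTerm X} : Cong R a b → Cong R c d → Cong R (a.mul c) (b.mul d)
  | rstar_congr {a b : RTerm X} : Cong R a b → Cong R a.rstar b.rstar
  | rplus_congr {a b : RTerm X} : Cong R a b → Cong R a.rplus b.rplus
  | mul_assoc (a b c : RTerm X) : Cong R ((a.mul b).mul c) (a.mul (b.mul c))
  | one_mul (a : RTerm X) : Cong R (RTerm.one.mul a) a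
  | mul_one (a : RTerm X) : Cong R (a.mul .one) a
  | mul_rstar_self (x : RTerm X) : Cong R (x.mul x.rstar) x
  | rstar_comm (x y : RTerm X) : Cong R (x.rstar.mul y.rstar) (y.rstar.mul x.rstar)
  | rstar_mul_rstar (x y : RTerm X) : Cong R (x.mul y.rstar).rstar (x.rstar.mul y.rstar)
  | rstar_mul (x y : RTerm X) : Cong R (x.rstar.mul y) (y.mul (x.mul y).rstar)
  | rplus_mul_self (x : RTerm X) : Cong R (x.rplus.mul x) x
  | rplus_comm (x y : RTerm X) : Cong R (x.rplus.mul y.rplus) (y.rplus.mul x.rplus)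
  | rplus_rplus_mul (x y : RTerm X) : Cong R (x.rplus.mul y).rplus (x.rplus.mul y.rplus)
  | mul_rplus (x y : RTerm X) : Cong R (x.mul y.rplus) ((x.mul y).rplus.mul x)
  | rstar_rplus (x : RTerm X) : Cong R x.rplus.rstar x.rplus
  | rplus_rstar (x : RTerm X) : Cong R x.rstar.rplus x.rstar

/-- The congruence `RTerm.Cong R` as a setoid. -/
def RTerm.setoid {X : Type u} (R : RTerm X → RTerm X → Prop) : Setoid (RTerm X) where
  r := RTerm.Cong R
  iseqv := ⟨.refl, .symm, .trans⟩

/-- The restriction monoid generated by `X` subject to the defining relations `R`. -/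
def PresentedRestrictionMonoid {X : Type u} (R : RTerm X → RTerm X → Prop) : Type u :=
  Quotient (RTerm.setoid R)

instance PresentedRestrictionMonoid.instRestrictionMonoid {X : Type u}
    (R : RTerm X → RTerm X → Prop) : RestrictionMonoid (PresentedRestrictionMonoid R) where
  mul := Quotient.map₂ RTerm.mul fun _ _ h _ _ h' => .mul_congr h h'
  one := Quotient.mk _ RTerm.one
  rstar := Quotient.map RTerm.rstar fun _ _ h => .rstar_congr h
  rplus := Quotient.map RTerm.rplus fun _ _ h => .rplus_congr h
  mul_assoc := by rintro ⟨a⟩ ⟨b⟩ ⟨c⟩; exact Quotient.sound (.mul_assoc a b c)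
  one_mul := by rintro ⟨a⟩; exact Quotient.sound (.one_mul a)
  mul_one := by rintro ⟨a⟩; exact Quotient.sound (.mul_one a)
  mul_rstar_self := by rintro ⟨x⟩; exact Quotient.sound (.mul_rstar_self x)
  rstar_comm := by rintro ⟨x⟩ ⟨y⟩; exact Quotient.sound (.rstar_comm x y)
  rstar_mul_rstar := by rintro ⟨x⟩ ⟨y⟩; exact Quotient.sound (.rstar_mul_rstar x y)
  rstar_mul := by rintro ⟨x⟩ ⟨y⟩; exact Quotient.sound (.rstar_mul x y)
  rplus_mul_self := by rintro ⟨x⟩; exact Quotient.sound (.rplus_mul_self x)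
  rplus_comm := by rintro ⟨x⟩ ⟨y⟩; exact Quotient.sound (.rplus_comm x y)
  rplus_rplus_mul := by rintro ⟨x⟩ ⟨y⟩; exact Quotient.sound (.rplus_rplus_mul x y)
  mul_rplus := by rintro ⟨x⟩ ⟨y⟩; exact Quotient.sound (.mul_rplus x y)
  rstar_rplus := by rintro ⟨x⟩; exact Quotient.sound (.rstar_rplus x)
  rplus_rstar := by rintro ⟨x⟩; exact Quotient.sound (.rplus_rstar x)

/-- The relations saying that `m ↦ ⌊m⌋` is a strong premorphism into a restriction monoid:
`⌊1⌋ = 1`, `⌊m⌋⌊n⌋ = ⌊m⌋^+ ⌊mn⌋` and `⌊m⌋⌊n⌋ = ⌊mn⌋⌊n⌋^*`. -/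
inductive FRs.Rel (M : Type u) [Monoid M] : RTerm M → RTerm M → Prop
  | one : FRs.Rel M (.of 1) .one
  | left (m n : M) :
      FRs.Rel M ((RTerm.of m).mul (.of n)) ((RTerm.of m).rplus.mul (.of (m * n)))
  | right (m n : M) :
      FRs.Rel M ((RTerm.of m).mul (.of n)) ((RTerm.of (m * n)).mul (RTerm.of n).rstar)

/-- The free restriction monoid over the monoid `M` with respect to strong premorphisms. -/
abbrev FRs (M : Type u) [Monoid M] : Type u := PresentedRestrictionMonoid (FRs.Rel M)

/-! ### Inverse monoids given by generators and relations -/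

/-- Terms of type `(2,1,0)` over a set `X` of generators. -/
inductive ITerm (X : Type u) : Type u
  | of : X → ITerm X
  | one : ITerm X
  | mul : ITerm X → ITerm X → ITerm X
  | inv : ITerm X → ITerm X

/-- The least congruence on the algebra of terms that contains the relations `R` and all
instances of the defining identities of inverse monoids. -/
inductive ITerm.Cong {X : Type u} (R : ITerm X → ITerm X → Prop) : ITerm X → ITerm X → Prop
  | rel {a b : ITerm X} : R a b → Cong R a b
  | refl (a : ITerm X) : Cong R a a
  | symm {a b : ITerm X} : Cong R a b → Cong R b a
  | trans {a b c : ITerm X} : Cong R a b → Cong R b c → Cong R a c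
  | mul_congr {a b c d : ITerm X} : Cong R a b → Cong R c d → Cong R (a.mul c) (b.mul d)
  | inv_congr {a b : ITerm X} : Cong R a b → Cong R a.inv b.inv
  | mul_assoc (a b c : ITerm X) : Cong R ((a.mul b).mul c) (a.mul (b.mul c))
  | one_mul (a : ITerm X) : Cong R (ITerm.one.mul a) a
  | mul_one (a : ITerm X) : Cong R (a.mul .one) a
  | inv_inv (x : ITerm X) : Cong R x.inv.inv x
  | mul_inv_rev (x y : ITerm X) : Cong R (x.mul y).inv (y.inv.mul x.inv)
  | mul_inv_mul_self (x : ITerm X) : Cong R ((x.mul x.inv).mul x) x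
  | mul_inv_comm (x y : ITerm X) :
      Cong R ((x.mul x.inv).mul (y.mul y.inv)) ((y.mul y.inv).mul (x.mul x.inv))

/-- The congruence `ITerm.Cong R` as a setoid. -/
def ITerm.setoid {X : Type u} (R : ITerm X → ITerm X → Prop) : Setoid (ITerm X) where
  r := ITerm.Cong R
  iseqv := ⟨.refl, .symm, .trans⟩

/-- The inverse monoid generated by `X` subject to the defining relations `R`. -/
def PresentedInverseMonoid {X : Type u} (R : ITerm X → ITerm X → Prop) : Type u :=
  Quotient (ITerm.setoid R)

instance PresentedInverseMonoid.instInverseMonoid {X : Type u}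
    (R : ITerm X → ITerm X → Prop) : InverseMonoid (PresentedInverseMonoid R) where
  mul := Quotient.map₂ ITerm.mul fun _ _ h _ _ h' => .mul_congr h h'
  one := Quotient.mk _ ITerm.one
  inv := Quotient.map ITerm.inv fun _ _ h => .inv_congr h
  mul_assoc := by rintro ⟨a⟩ ⟨b⟩ ⟨c⟩; exact Quotient.sound (.mul_assoc a b c)
  one_mul := by rintro ⟨a⟩; exact Quotient.sound (.one_mul a)
  mul_one := by rintro ⟨a⟩; exact Quotient.sound (.mul_one a)
  inv_inv' := by rintro ⟨x⟩; exact Quotient.sound (.inv_inv x)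
  mul_inv_rev' := by rintro ⟨x⟩ ⟨y⟩; exact Quotient.sound (.mul_inv_rev x y)
  mul_inv_mul_self := by rintro ⟨x⟩; exact Quotient.sound (.mul_inv_mul_self x)
  mul_inv_comm := by rintro ⟨x⟩ ⟨y⟩; exact Quotient.sound (.mul_inv_comm x y)

/-- The relations saying that `m ↦ [m]` is a strong premorphism into an inverse monoid:
`[1] = 1`, `[m][n] = [m][m]⁻¹[mn]` and `[m][n] = [mn][n]⁻¹[n]`. -/
inductive FIs.Rel (M : Type u) [Monoid M] : ITerm M → ITerm M → Prop
  | one : FIs.Rel M (.of 1) .one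
  | left (m n : M) :
      FIs.Rel M ((ITerm.of m).mul (.of n))
        (((ITerm.of m).mul (ITerm.of m).inv).mul (.of (m * n)))
  | right (m n : M) :
      FIs.Rel M ((ITerm.of m).mul (.of n))
        ((ITerm.of (m * n)).mul ((ITerm.of n).inv.mul (ITerm.of n)))

/-- The free inverse monoid over the monoid `M` with respect to strong premorphisms. -/
abbrev FIs (M : Type u) [Monoid M] : Type u := PresentedInverseMonoid (FIs.Rel M)

/-! ### The Birget–Rhodes prefix expansion of a group -/

/-- The prefix expansion of a group `G`: the pairs `(A, g)` where `A` is a finite subset of `G`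
containing `1` and `g`. -/
@[ext] structure PrefixExpansion (G : Type u) [Group G] : Type u where
  set : Set G
  elt : G
  finite : set.Finite
  one_mem : 1 ∈ set
  elt_mem : elt ∈ set

namespace PrefixExpansion

variable {G : Type u} [Group G]

/-- The multiplication `(A, g)(B, h) = (A ∪ gB, gh)`. -/
instance : Mul (PrefixExpansion G) where
  mul a b :=
    { set := a.set ∪ (fun x => a.elt * x) '' b.set
      elt := a.elt * b.elt
      finite := a.finite.union (b.finite.image _)
      one_mem := Or.inl a.one_mem
      elt_mem := Or.inr ⟨_, b.elt_mem, rfl⟩ }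

/-- The identity element `({1}, 1)`. -/
instance : One (PrefixExpansion G) where
  one :=
    { set := {1}
      elt := 1
      finite := Set.finite_singleton 1
      one_mem := rfl
      elt_mem := rfl }

/-- The inversion `(A, g)⁻¹ = (g⁻¹A, g⁻¹)`. -/
instance : Inv (PrefixExpansion G) where
  inv a :=
    { set := (fun x => a.elt⁻¹ * x) '' a.set
      elt := a.elt⁻¹
      finite := a.finite.image _
      one_mem := ⟨_, a.elt_mem, inv_mul_cancel _⟩
      elt_mem := ⟨_, a.one_mem, mul_one _⟩ }

@[simp] theorem mul_set (a b : PrefixExpansion G) :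
    (a * b).set = a.set ∪ (fun x => a.elt * x) '' b.set := rfl
@[simp] theorem mul_elt (a b : PrefixExpansion G) : (a * b).elt = a.elt * b.elt := rfl
@[simp] theorem one_set : (1 : PrefixExpansion G).set = {1} := rfl
@[simp] theorem one_elt : (1 : PrefixExpansion G).elt = 1 := rfl
@[simp] theorem inv_set (a : PrefixExpansion G) :
    a⁻¹.set = (fun x => a.elt⁻¹ * x) '' a.set := rfl
@[simp] theorem inv_elt (a : PrefixExpansion G) : a⁻¹.elt = a.elt⁻¹ := rfl

instance : InverseMonoid (PrefixExpansion G) where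
  mul_assoc a b c := by
    ext1
    · simp [-Set.image_mul_left, Set.image_union, Set.image_image, Set.union_assoc, mul_assoc]
    · simp [mul_assoc]
  one_mul a := by
    ext1
    · simpa using a.one_mem
    · simp
  mul_one a := by
    ext1
    · simpa using a.elt_mem
    · simp
  inv_inv' a := by
    ext1 <;> simp [-Set.image_mul_left, Set.image_image]
  mul_inv_rev' a b := by
    ext1
    · simp [-Set.image_mul_left, Set.image_union, Set.image_image, Set.union_comm, mul_assoc]
    · simp
  mul_inv_mul_self a := by
    ext1
    · simp [-Set.image_mul_left, Set.image_image]
    · simp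
  mul_inv_comm a b := by
    ext1
    · simp [-Set.image_mul_left, Set.image_image, Set.union_comm]
    · simp

/-- The pairs `(A, g)` above are exactly the pairs consisting of the set
`{1, g₁, g₁g₂, …, g₁g₂⋯gₙ}` of values of all prefixes of a word `g₁g₂…gₙ` over `G` and of the
value `g₁g₂⋯gₙ` of the word. -/
theorem exists_word_iff (A : Set G) (g : G) :
    (∃ l : List G, A = {x | ∃ p : List G, p <+: l ∧ p.prod = x} ∧ l.prod = g) ↔
      A.Finite ∧ 1 ∈ A ∧ g ∈ A := by
  constructor
  · rintro ⟨l, rfl, rfl⟩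
    refine ⟨?_, ⟨[], List.nil_prefix, rfl⟩, ⟨l, List.prefix_rfl, rfl⟩⟩
    refine (l.inits.map List.prod).finite_toSet.subset ?_
    rintro x ⟨p, hp, rfl⟩
    exact List.mem_map.2 ⟨p, (List.mem_inits p l).2 hp, rfl⟩
  · rintro ⟨hA, h1, hg⟩
    have step : ∀ (l : List G) (y : G),
        {x | ∃ p : List G, p <+: l ++ [l.prod⁻¹ * y] ∧ p.prod = x} =
          insert y {x | ∃ p : List G, p <+: l ∧ p.prod = x} := by
      intro l y
      ext x
      simp only [Set.mem_ofPred_eq, Set.mem_insert_iff, List.prefix_concat_iff]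
      constructor
      · rintro ⟨p, rfl | hp, rfl⟩
        · left; simp
        · exact Or.inr ⟨p, hp, rfl⟩
      · rintro (rfl | ⟨p, hp, rfl⟩)
        · exact ⟨_, Or.inl rfl, by simp⟩
        · exact ⟨p, Or.inr hp, rfl⟩
    have key : ∃ l : List G, insert 1 A = {x | ∃ p : List G, p <+: l ∧ p.prod = x} := by
      clear h1 hg
      induction A, hA using Set.Finite.induction_on_subset with
      | empty => exact ⟨[], by ext x; simp [eq_comm]⟩
      | insert _ _ _ ih =>
        obtain ⟨l, hl⟩ := ih
        exact ⟨_, by rw [Set.insert_comm, hl, step]⟩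
    obtain ⟨l, hl⟩ := key
    rw [Set.insert_eq_of_mem h1] at hl
    refine ⟨l ++ [l.prod⁻¹ * g], ?_, by simp⟩
    rw [step, ← hl, Set.insert_eq_of_mem hg]

end PrefixExpansion

/-! ### Projections of a restriction monoid -/

namespace RestrictionMonoid

/-! Let `a` be a strong premorphism of `G` into any restriction monoid, and put e_g = a(g)^+.
Invertibility in `G` forces a(g)^* = e_{g⁻¹} (`rstar_toFun`), so stars of generators are again among
the e_g. These are commuting idempotents, and a(g) e_h = e_{gh} a(g) (`toFun_mul_proj`): generators
act on them by left translation. Every element generated by the a(g) can therefore be written (∏_{h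
∈ A} e_h) a(g); since e_1 = 1 and e_g a(g) = a(g), one may take 1, g ∈ A. Such expressions multiply
as the pairs (A, g) do, so `lift` is a homomorphism from the prefix expansion that also respects ^+
and ^* (`lift_mul`, `rplus_lift`, `rstar_lift`).

Conversely, the elements ({1, g}, g) satisfy both sets of defining relations, so evaluating terms
maps `FRs G` and `FIs G` to the prefix expansion. For the canonical premorphisms, evaluation and
`lift` are mutually inverse (`lift_eval`, `leftInverse_lift`). The inverse operation on `FRs G` is
transported along this bijection, and the isomorphism with `FIs G` passes through the prefix
expansion. -/

theorem eq_of_toMonoid_eq {S : Type v} {A B : RestrictionMonoid S}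
    (h : A.toMonoid = B.toMonoid) (hstar : A.rstar = B.rstar) (hplus : A.rplus = B.rplus) :
    A = B := by
  cases A
  cases B
  cases h
  cases hstar
  cases hplus
  rfl

/-- The submonoid of projections, that is, of the elements fixed by `x ↦ x^+`. -/
def projections (S : Type v) [RestrictionMonoid S] : Submonoid S where
  carrier := {e | rplus e = e}
  one_mem' := by
    have h := rplus_mul_self (1 : S)
    rwa [mul_one] at h
  mul_mem' := by
    intro x y (hx : rplus x = x) (hy : rplus y = y)
    have h := rplus_rplus_mul x y
    rwa [hx, hy] at h

variable {S : Type v} [RestrictionMonoid S]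

theorem rplus_idem (x : S) : rplus (rplus x) = rplus x := by
  rw [← rstar_rplus x, rplus_rstar]

theorem projections.rplus_eq (e : projections S) : rplus (e : S) = e := e.2

theorem projections.rstar_eq (e : projections S) : rstar (e : S) = e := by
  rw [← projections.rplus_eq e, rstar_rplus]

/-- Commutativity makes products of projections over finite sets meaningful, independently of any
order. -/
instance : CommMonoid (projections S) where
  mul_comm e f := Subtype.ext <| by
    rw [Submonoid.coe_mul, Submonoid.coe_mul, ← projections.rplus_eq e,
      ← projections.rplus_eq f, rplus_comm]

theorem projections.mul_self (e : projections S) : e * e = e := Subtype.ext <| by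
  have h := rplus_mul_self (e : S)
  rwa [projections.rplus_eq] at h

end RestrictionMonoid

/-- The right side counts the factors over `s ∩ t` twice, and idempotence absorbs the second copy.
Thus unions of sets become products of projections without any disjointness assumption. -/
theorem Finset.prod_union_of_mul_self {ι : Type u} {M : Type v} [DecidableEq ι] [CommMonoid M]
    (hM : ∀ x : M, x * x = x) (f : ι → M) (s t : Finset ι) :
    ∏ i ∈ s ∪ t, f i = (∏ i ∈ s, f i) * ∏ i ∈ t, f i := by
  rw [← Finset.prod_union_inter, ← Finset.union_sdiff_of_subset (Finset.inter_subset_union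
    (s := s) (t := t)), Finset.prod_union Finset.disjoint_sdiff, mul_right_comm, hM]

open RestrictionMonoid

/-! ### Strong premorphisms of a group into a restriction monoid -/

/-- Strong premorphisms `G → S`. -/
structure StrongPremorphism (G : Type u) (S : Type v) [Group G] [RestrictionMonoid S] where
  toFun : G → S
  map_one : toFun 1 = 1
  mul_left : ∀ g h, toFun g * toFun h = rplus (toFun g) * toFun (g * h)
  mul_right : ∀ g h, toFun g * toFun h = toFun (g * h) * rstar (toFun h)

namespace StrongPremorphism

variable {G : Type u} {S : Type v} [Group G] [RestrictionMonoid S] (a : StrongPremorphism G S)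

/-- The projection `a(g)^+`. -/
def proj (g : G) : projections S := ⟨rplus (a.toFun g), rplus_idem _⟩

theorem coe_proj (g : G) : (a.proj g : S) = rplus (a.toFun g) := rfl

/-- The two premorphism laws compute a(g⁻¹)a(g) in two ways: as a(g⁻¹)^+ and as a(g)^*. -/
theorem rstar_toFun (g : G) : rstar (a.toFun g) = a.proj g⁻¹ := by
  have h₁ := a.mul_left g⁻¹ g
  have h₂ := a.mul_right g⁻¹ g
  rw [inv_mul_cancel, a.map_one, mul_one] at h₁
  rw [inv_mul_cancel, a.map_one, one_mul] at h₂
  rw [coe_proj, ← h₁, h₂]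

/-- Moving the projection across gives (a(g)a(h))^+ a(g) = a(gh)^+ a(g)^+ a(g), and a(g)^+ is
absorbed by a(g). -/
theorem toFun_mul_proj (g h : G) : a.toFun g * a.proj h = a.proj (g * h) * a.toFun g := by
  rw [coe_proj, mul_rplus, a.mul_left, rplus_rplus_mul, rplus_comm, mul_assoc, rplus_mul_self,
    coe_proj]

theorem toFun_mul_prod [DecidableEq G] (g : G) (s : Finset G) :
    a.toFun g * (∏ h ∈ s, a.proj h : projections S) =
      (∏ h ∈ s.image (g * ·), a.proj h : projections S) * a.toFun g := by
  rw [Finset.prod_image (mul_right_injective g).injOn]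
  induction s using Finset.induction_on with
  | empty => simp
  | insert h s hs ih =>
    rw [Finset.prod_insert hs, Finset.prod_insert hs, Submonoid.coe_mul, Submonoid.coe_mul,
      ← mul_assoc, toFun_mul_proj, mul_assoc, ih, mul_assoc]

/-- The projection `∏_{h ∈ A} a(h)^+` of an element `(A, g)` of the prefix expansion. -/
noncomputable def setProj (x : PrefixExpansion G) : projections S :=
  ∏ h ∈ x.finite.toFinset, a.proj h

theorem setProj_congr {x y : PrefixExpansion G} (h : x.set = y.set) :
    a.setProj x = a.setProj y := by
  unfold setProj
  congr 1
  ext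
  simp [h]

theorem setProj_one : a.setProj 1 = 1 := by
  have h : (1 : PrefixExpansion G).finite.toFinset = {1} := by ext; simp
  rw [setProj, h, Finset.prod_singleton]
  exact Subtype.ext (by rw [coe_proj, a.map_one]; exact (projections S).one_mem)

theorem setProj_mul_proj (x : PrefixExpansion G) {g : G} (hg : g ∈ x.set) :
    a.setProj x * a.proj g = a.setProj x := by
  classical
  rw [setProj, ← Finset.mul_prod_erase _ _ (x.finite.mem_toFinset.2 hg), mul_right_comm,
    projections.mul_self]

theorem setProj_mul [DecidableEq G] (x y : PrefixExpansion G) :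
    a.setProj (x * y) =
      a.setProj x * ∏ h ∈ y.finite.toFinset.image (x.elt * ·), a.proj h := by
  have h : (x * y).finite.toFinset =
      x.finite.toFinset ∪ y.finite.toFinset.image (x.elt * ·) := by
    ext; simp only [Set.Finite.mem_toFinset, PrefixExpansion.mul_set, Finset.mem_union,
      Finset.mem_image, Set.mem_union, Set.mem_image]
  rw [setProj, h, Finset.prod_union_of_mul_self projections.mul_self, setProj]

/-- The map `(A, g) ↦ (∏_{h ∈ A} a(h)^+) a(g)` extending a strong premorphism to the prefix
expansion. -/
noncomputable def lift (x : PrefixExpansion G) : S := a.setProj x * a.toFun x.elt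

theorem lift_one : a.lift 1 = 1 := by
  rw [lift, setProj_one, PrefixExpansion.one_elt, a.map_one, Submonoid.coe_one, one_mul]

theorem lift_mul (x y : PrefixExpansion G) : a.lift (x * y) = a.lift x * a.lift y := by
  classical
  -- As `x.elt` lies in the set of `x * y`, the factor a(x.elt)^+ may be inserted for free; it lets
  -- the left premorphism law be read backwards, splitting a(gh) into a(g)a(h). The projections of
  -- `y` are then moved left across a(g).
  calc a.lift (x * y)
      = (a.setProj (x * y) * a.proj x.elt : projections S) * a.toFun (x.elt * y.elt) := by
        rw [setProj_mul_proj _ _ (Or.inl x.elt_mem), lift, PrefixExpansion.mul_elt]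
    _ = a.setProj (x * y) * (a.toFun x.elt * a.toFun y.elt) := by
        rw [a.mul_left, Submonoid.coe_mul, coe_proj, mul_assoc]
    _ = a.setProj x * (a.toFun x.elt * a.setProj y) * a.toFun y.elt := by
        rw [setProj_mul, setProj.eq_1 a y, toFun_mul_prod, Submonoid.coe_mul]
        simp only [mul_assoc]
    _ = a.lift x * a.lift y := by
        simp only [lift, mul_assoc]

theorem lift_of_elt_eq_one {x : PrefixExpansion G} (h : x.elt = 1) : a.lift x = a.setProj x := by
  rw [lift, h, a.map_one, mul_one]

/-- For x = (A, g), the left side is e_A e_g, where e_A = ∏_{h ∈ A} e_h. The factor e_g is absorbed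
because g ∈ A, and x x⁻¹ = (A, 1). -/
theorem rplus_lift (x : PrefixExpansion G) : rplus (a.lift x) = a.lift (x * x⁻¹) := by
  have hs : (x * x⁻¹).set = x.set := by simp [-Set.image_mul_left, Set.image_image]
  rw [a.lift_of_elt_eq_one (x := x * x⁻¹) (mul_inv_cancel _), a.setProj_congr hs, lift,
    ← projections.rplus_eq (a.setProj x), rplus_rplus_mul, projections.rplus_eq,
    ← coe_proj, ← Submonoid.coe_mul, setProj_mul_proj _ _ x.elt_mem]

/-- The dual normal form: moving the projections to the right of a(g) translates their index set by
g⁻¹. This is the form to which the identities for ^* apply. -/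
theorem lift_eq_toFun_mul (x : PrefixExpansion G) :
    a.lift x = a.toFun x.elt * a.setProj x⁻¹ := by
  classical
  have h : x⁻¹.finite.toFinset.image (x.elt * ·) = x.finite.toFinset := by
    ext; simp
  rw [lift, setProj.eq_1 a x⁻¹, toFun_mul_prod, h, setProj]

/-- In the dual normal form a(g)^* = e_{g⁻¹} is absorbed, since g⁻¹ ∈ g⁻¹A. -/
theorem rstar_lift (x : PrefixExpansion G) : rstar (a.lift x) = a.lift (x⁻¹ * x) := by
  have hs : (x⁻¹ * x).set = x⁻¹.set := by simp [-Set.image_mul_left]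
  rw [a.lift_of_elt_eq_one (x := x⁻¹ * x) (inv_mul_cancel _), a.setProj_congr hs,
    lift_eq_toFun_mul, ← projections.rstar_eq (a.setProj x⁻¹), rstar_mul_rstar, rstar_toFun,
    projections.rstar_eq, ← Submonoid.coe_mul, mul_comm, ← PrefixExpansion.inv_elt,
    setProj_mul_proj _ _ x⁻¹.elt_mem]

end StrongPremorphism

/-! ### The generators of the prefix expansion -/

namespace PrefixExpansion

variable {G : Type u} [Group G]

/-- The element `({1, g}, g)`. -/
def of (g : G) : PrefixExpansion G where
  set := {1, g}
  elt := g
  finite := Set.toFinite _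
  one_mem := Or.inl rfl
  elt_mem := Or.inr rfl

theorem of_one : of (1 : G) = 1 := by
  ext1
  · exact Set.pair_eq_singleton 1
  · rfl

/-- Both sides equal ({1, g, gh}, gh); the same holds in `of_mul_of_right`. -/
theorem of_mul_of_left (g h : G) : of g * of h = of g * (of g)⁻¹ * of (g * h) := by
  ext1
  · ext; simp [of, -Set.image_mul_left, Set.image_pair]
  · simp [of]

theorem of_mul_of_right (g h : G) : of g * of h = of (g * h) * ((of h)⁻¹ * of h) := by
  ext1
  · ext; simp [of, -Set.image_mul_left, Set.image_pair]; tauto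
  · simp [of]

end PrefixExpansion

theorem StrongPremorphism.lift_of {G : Type u} {S : Type v} [Group G] [RestrictionMonoid S]
    (a : StrongPremorphism G S) (g : G) : a.lift (.of g) = a.toFun g := by
  classical
  -- Written as a union, the set needs no case distinction on g = 1.
  have h : (PrefixExpansion.of g).finite.toFinset = {1} ∪ {g} := by
    ext; simp [PrefixExpansion.of]
  have h₁ := a.setProj_one
  rw [setProj, show (1 : PrefixExpansion G).finite.toFinset = {1} by ext; simp] at h₁
  rw [lift, setProj, h, Finset.prod_union_of_mul_self projections.mul_self, h₁, one_mul,
    Finset.prod_singleton, coe_proj]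
  exact rplus_mul_self _

/-- A homomorphism into the prefix expansion that sends `a(g)` to `({1, g}, g)` for all `g` is a
left inverse of `a.lift`. -/
theorem StrongPremorphism.leftInverse_lift {G : Type u} {S : Type v} [Group G]
    [RestrictionMonoid S] (a : StrongPremorphism G S) (ψ : S →* PrefixExpansion G)
    (hψ : ∀ g, ψ (a.toFun g) = .of g)
    (hplus : ∀ s, ψ (rplus s) = ψ s * (ψ s)⁻¹) :
    Function.LeftInverse ψ a.lift := by
  classical
  -- Each e_h goes to ({1, h}, 1), and such pairs multiply by taking unions of their sets. The point
  -- 1 is present even for empty `s`.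
  have key : ∀ s : Finset G, ψ (∏ h ∈ s, a.proj h : projections S) =
      ⟨insert 1 s, 1, s.finite_toSet.insert 1, Set.mem_insert _ _, Set.mem_insert _ _⟩ := by
    intro s
    induction s using Finset.induction_on with
    | empty =>
      rw [Finset.prod_empty, Submonoid.coe_one, _root_.map_one]
      ext1 <;> simp
    | insert h s hs ih =>
      rw [Finset.prod_insert hs, Submonoid.coe_mul, map_mul, ih, coe_proj, hplus, hψ]
      ext1
      · ext
        simp [PrefixExpansion.of, -Set.image_mul_left, Set.image_pair]
        tauto
      · simp
  intro x
  rw [lift, map_mul, setProj, key, hψ]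
  -- The product (A, 1)({1, g}, g) has set A ∪ {1, g}, which is A because 1, g ∈ A.
  ext1
  · have h1 := x.one_mem
    have h2 := x.elt_mem
    ext y
    simp only [PrefixExpansion.of, PrefixExpansion.mul_set, Set.Finite.coe_toFinset,
      Set.insert_eq_of_mem h1, one_mul, Set.image_id', Set.mem_union, Set.mem_insert_iff,
      Set.mem_singleton_iff]
    constructor
    · rintro (h | rfl | rfl) <;> assumption
    · exact Or.inl
  · simp [PrefixExpansion.of]

/-! ### The map of `FRs G` onto the prefix expansion -/

namespace FRs

variable {G : Type u} [Group G]

/-- The canonical strong premorphism of `G` into `FRs G`. -/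
def premorphism (G : Type u) [Group G] : StrongPremorphism G (FRs G) where
  toFun g := Quotient.mk _ (.of g)
  map_one := Quotient.sound (.rel .one)
  mul_left g h := Quotient.sound (.rel (.left g h))
  mul_right g h := Quotient.sound (.rel (.right g h))

/-- The value of a term in the prefix expansion. -/
def eval : RTerm G → PrefixExpansion G
  | .of g => .of g
  | .one => 1
  | .mul x y => eval x * eval y
  | .rstar x => (eval x)⁻¹ * eval x
  | .rplus x => eval x * (eval x)⁻¹

theorem eval_eq_of_cong {x y : RTerm G} (h : RTerm.Cong (FRs.Rel G) x y) : eval x = eval y := by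
  -- The clauses of `eval` for `rstar` and `rplus` are by definition the operations of this
  -- structure, so its axioms settle the corresponding cases.
  let := InverseMonoid.toRestrictionMonoid (PrefixExpansion G)
  induction h with
  | rel h =>
    cases h with
    | one => exact PrefixExpansion.of_one
    | left g h => exact PrefixExpansion.of_mul_of_left g h
    | right g h => exact PrefixExpansion.of_mul_of_right g h
  | refl => rfl
  | symm _ ih => exact ih.symm
  | trans _ _ ih₁ ih₂ => exact ih₁.trans ih₂
  | mul_congr _ _ ih₁ ih₂ => simp only [eval, ih₁, ih₂]
  | rstar_congr _ ih => simp only [eval, ih]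
  | rplus_congr _ ih => simp only [eval, ih]
  | mul_assoc => exact mul_assoc _ _ _
  | one_mul => exact one_mul _
  | mul_one => exact mul_one _
  | mul_rstar_self x => exact mul_rstar_self (eval x)
  | rstar_comm x y => exact rstar_comm (eval x) (eval y)
  | rstar_mul_rstar x y => exact rstar_mul_rstar (eval x) (eval y)
  | rstar_mul x y => exact rstar_mul (eval x) (eval y)
  | rplus_mul_self x => exact rplus_mul_self (eval x)
  | rplus_comm x y => exact rplus_comm (eval x) (eval y)
  | rplus_rplus_mul x y => exact rplus_rplus_mul (eval x) (eval y)
  | mul_rplus x y => exact mul_rplus (eval x) (eval y)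
  | rstar_rplus x => exact rstar_rplus (eval x)
  | rplus_rstar x => exact rplus_rstar (eval x)

/-- The canonical homomorphism of `FRs G` into the prefix expansion. -/
def toPrefix (G : Type u) [Group G] : FRs G →* PrefixExpansion G where
  toFun := Quotient.lift eval fun _ _ => eval_eq_of_cong
  map_one' := rfl
  map_mul' := by rintro ⟨x⟩ ⟨y⟩; rfl

theorem toPrefix_rplus (x : FRs G) : toPrefix G (rplus x) = toPrefix G x * (toPrefix G x)⁻¹ := by
  rcases x with ⟨x⟩; rfl

theorem toPrefix_rstar (x : FRs G) : toPrefix G (rstar x) = (toPrefix G x)⁻¹ * toPrefix G x := by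
  rcases x with ⟨x⟩; rfl

/-- Every term reduces to the normal form of its value, because `lift` respects all operations and
fixes the generators. Hence terms with equal values are congruent. -/
theorem lift_eval (x : RTerm G) :
    (premorphism G).lift (eval x) = (Quotient.mk _ x : FRs G) := by
  induction x with
  | of g => exact (premorphism G).lift_of g
  | one => exact (premorphism G).lift_one
  | mul x y hx hy => rw [eval, StrongPremorphism.lift_mul, hx, hy]; rfl
  | rstar x hx => rw [eval, ← StrongPremorphism.rstar_lift, hx]; rfl
  | rplus x hx => rw [eval, ← StrongPremorphism.rplus_lift, hx]; rfl

/-- The isomorphism of `FRs G` with the prefix expansion. -/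
noncomputable def equivPrefix (G : Type u) [Group G] : FRs G ≃* PrefixExpansion G where
  __ := toPrefix G
  invFun := (premorphism G).lift
  left_inv := by rintro ⟨x⟩; exact lift_eval x
  right_inv := (premorphism G).leftInverse_lift (toPrefix G) (fun _ => rfl) toPrefix_rplus

theorem equivPrefix_rplus (x : FRs G) :
    equivPrefix G (rplus x) = equivPrefix G x * (equivPrefix G x)⁻¹ := toPrefix_rplus x

theorem equivPrefix_rstar (x : FRs G) :
    equivPrefix G (rstar x) = (equivPrefix G x)⁻¹ * equivPrefix G x := toPrefix_rstar x

/-- The inverse monoid structure of `FRs G`. -/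
noncomputable instance : InverseMonoid (FRs G) where
  inv x := (equivPrefix G).symm (equivPrefix G x)⁻¹
  inv_inv' x := by simp [InverseMonoid.inv_inv']
  mul_inv_rev' x y := by simp [InverseMonoid.mul_inv_rev']
  mul_inv_mul_self x := (equivPrefix G).injective <| by
    simp [InverseMonoid.mul_inv_mul_self]
  mul_inv_comm x y := (equivPrefix G).injective <| by
    simp only [map_mul, MulEquiv.apply_symm_apply]
    exact InverseMonoid.mul_inv_comm _ _

theorem equivPrefix_inv (x : FRs G) : equivPrefix G x⁻¹ = (equivPrefix G x)⁻¹ :=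
  (equivPrefix G).apply_symm_apply _

theorem toRestrictionMonoid_eq (G : Type u) [Group G] :
    InverseMonoid.toRestrictionMonoid (FRs G) =
      PresentedRestrictionMonoid.instRestrictionMonoid (FRs.Rel G) := by
  -- The inverse monoid structure reuses the presented multiplication and identity, so only the two
  -- unary operations remain to be compared, in the prefix expansion.
  refine RestrictionMonoid.eq_of_toMonoid_eq rfl (funext fun x => ?_) (funext fun x => ?_)
  · apply (equivPrefix G).injective
    calc equivPrefix G (x⁻¹ * x) = equivPrefix G x⁻¹ * equivPrefix G x := map_mul _ _ _
      _ = _ := by rw [equivPrefix_inv, ← equivPrefix_rstar]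
  · apply (equivPrefix G).injective
    calc equivPrefix G (x * x⁻¹) = equivPrefix G x * equivPrefix G x⁻¹ := map_mul _ _ _
      _ = _ := by rw [equivPrefix_inv, ← equivPrefix_rplus]

end FRs

/-! ### The map of `FIs G` onto the prefix expansion -/

namespace FIs

variable {G : Type u} [Group G]

/-- The restriction monoid associated with the inverse monoid `FIs G`. -/
instance : RestrictionMonoid (FIs G) := InverseMonoid.toRestrictionMonoid _

/-- The canonical strong premorphism of `G` into `FIs G`. -/
def premorphism (G : Type u) [Group G] : StrongPremorphism G (FIs G) where
  toFun g := Quotient.mk _ (.of g)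
  map_one := Quotient.sound (.rel .one)
  mul_left g h := Quotient.sound (.rel (.left g h))
  mul_right g h := Quotient.sound (.rel (.right g h))

/-- The value of a term in the prefix expansion. -/
def eval : ITerm G → PrefixExpansion G
  | .of g => .of g
  | .one => 1
  | .mul x y => eval x * eval y
  | .inv x => (eval x)⁻¹

theorem eval_eq_of_cong {x y : ITerm G} (h : ITerm.Cong (FIs.Rel G) x y) : eval x = eval y := by
  induction h with
  | rel h =>
    cases h with
    | one => exact PrefixExpansion.of_one
    | left g h => exact PrefixExpansion.of_mul_of_left g h
    | right g h => exact PrefixExpansion.of_mul_of_right g h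
  | refl => rfl
  | symm _ ih => exact ih.symm
  | trans _ _ ih₁ ih₂ => exact ih₁.trans ih₂
  | mul_congr _ _ ih₁ ih₂ => simp only [eval, ih₁, ih₂]
  | inv_congr _ ih => simp only [eval, ih]
  | mul_assoc => exact mul_assoc _ _ _
  | one_mul => exact one_mul _
  | mul_one => exact mul_one _
  | inv_inv x => exact InverseMonoid.inv_inv' (eval x)
  | mul_inv_rev x y => exact InverseMonoid.mul_inv_rev' (eval x) (eval y)
  | mul_inv_mul_self x => exact InverseMonoid.mul_inv_mul_self (eval x)
  | mul_inv_comm x y => exact InverseMonoid.mul_inv_comm (eval x) (eval y)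

/-- The canonical homomorphism of `FIs G` into the prefix expansion. -/
def toPrefix (G : Type u) [Group G] : FIs G →* PrefixExpansion G where
  toFun := Quotient.lift eval fun _ _ => eval_eq_of_cong
  map_one' := rfl
  map_mul' := by rintro ⟨x⟩ ⟨y⟩; rfl

theorem toPrefix_inv (x : FIs G) : toPrefix G x⁻¹ = (toPrefix G x)⁻¹ := by
  rcases x with ⟨x⟩; rfl

/-- A homomorphism respecting ^+ and ^* also respects inverses: y = φ(x⁻¹) satisfies y φ(x) =
φ(x)⁻¹φ(x), φ(x) y = φ(x)φ(x)⁻¹ and y = y φ(x) y, which force y = φ(x)⁻¹. -/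
theorem lift_inv (x : PrefixExpansion G) :
    (premorphism G).lift x⁻¹ = ((premorphism G).lift x)⁻¹ := by
  set φ := (premorphism G).lift
  have h₁ : φ x * φ x⁻¹ = φ x * (φ x)⁻¹ :=
    ((premorphism G).lift_mul _ _).symm.trans ((premorphism G).rplus_lift x).symm
  have h₂ : φ x⁻¹ * φ x = (φ x)⁻¹ * φ x :=
    ((premorphism G).lift_mul _ _).symm.trans ((premorphism G).rstar_lift x).symm
  calc φ x⁻¹ = φ (x⁻¹ * x * x⁻¹) := by rw [InverseMonoid.inv_mul_mul_inv]
    _ = φ x⁻¹ * φ x * φ x⁻¹ := by simp only [φ, StrongPremorphism.lift_mul]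
    _ = (φ x)⁻¹ * φ x * (φ x)⁻¹ := by rw [h₂, mul_assoc, h₁, mul_assoc]
    _ = (φ x)⁻¹ := InverseMonoid.inv_mul_mul_inv _

theorem lift_eval (x : ITerm G) :
    (premorphism G).lift (eval x) = (Quotient.mk _ x : FIs G) := by
  induction x with
  | of g => exact (premorphism G).lift_of g
  | one => exact (premorphism G).lift_one
  | mul x y hx hy => rw [eval, StrongPremorphism.lift_mul, hx, hy]; rfl
  | inv x hx => rw [eval, lift_inv, hx]; rfl

/-- The isomorphism of `FIs G` with the prefix expansion. -/
noncomputable def equivPrefix (G : Type u) [Group G] : FIs G ≃* PrefixExpansion G where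
  __ := toPrefix G
  invFun := (premorphism G).lift
  left_inv := by rintro ⟨x⟩; exact lift_eval x
  right_inv := (premorphism G).leftInverse_lift (toPrefix G) (fun _ => rfl)
    (fun x => by rw [← toPrefix_inv, ← map_mul]; rfl)

theorem equivPrefix_symm_inv (x : PrefixExpansion G) :
    (equivPrefix G).symm x⁻¹ = ((equivPrefix G).symm x)⁻¹ := lift_inv x

end FIs

/-- For a group `G`, the restriction monoid `FRs G` is an inverse monoid (its operations are the
restriction monoid operations `x^* = x⁻¹ x`, `x^+ = x x⁻¹` of an inverse monoid structure), and as
an inverse monoid it is isomorphic to `FIs G` and to the prefix expansion of `G`. -/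
theorem mainTheorem8 (G : Type u) [Group G] :
    ∃ I : InverseMonoid (FRs G),
      @InverseMonoid.toRestrictionMonoid (FRs G) I =
        PresentedRestrictionMonoid.instRestrictionMonoid (FRs.Rel G) ∧
      Nonempty (@InverseMonoidIso (FRs G) (FIs G) I inferInstance) ∧
      Nonempty (@InverseMonoidIso (FRs G) (PrefixExpansion G) I inferInstance) := by
  refine ⟨inferInstance, FRs.toRestrictionMonoid_eq G,
    ⟨(FRs.equivPrefix G).trans (FIs.equivPrefix G).symm, fun x => ?_⟩,
    ⟨FRs.equivPrefix G, FRs.equivPrefix_inv⟩⟩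
  exact (congrArg (FIs.equivPrefix G).symm (FRs.equivPrefix_inv x)).trans
    (FIs.equivPrefix_symm_inv _)
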